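/- Let $\mathcal X\subset\mathbb R^{d}$ (data space), $\mathcal Z\subset\mathbb R^{d_z}$ (latent space), $\Phi\subset\mathbb R^{d_\phi}$ and $\Theta\subset\mathbb R^{d_\theta}$ (encoder and decoder parameters), with Euclidean norms, and let $\Delta>0$ satisfy $\sup_{x,x'\in\mathcal X}\|x-x'\|<\Delta^{1/2}$. Let $\mathcal D$ be a probability distribution on $\mathcal X$, let $n\ge 1$, and let $S=(S_1,\dots,S_n)$ be i.i.d. with law $\mathcal D$. A randomized learning algorithm (a Markov kernel) draws parameters $(\mathbf e,\phi,\theta)\sim q(\mathbf e,\phi,\theta\mid S)$, where $\mathbf e=(e_1,\dots,e_K)\in\mathcal Z^K$ is a codebook, $\phi\in\Phi$ and $\theta\in\Theta$. Let $q(J\mid\mathbf e,\phi,x)$ be the posterior on the latent index $J\in\{1,\dots,K\}$ of a data point $x$ (a Markov kernel; in particular, a softmax or a nearest-codeword encoder), let $g_\theta:\mathcal Z\to\mathcal X$ be decoders that are measurable for every $\theta\in\Theta$, and let $l(x,x')=\|x-x'\|^2$. Let $\pi(J\mid\mathbf e,\phi)$ be any data-independent prior, that is, any Markov kernel from $\mathcal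 Z^K\times\Phi$ to $\{1,\dots,K\}$, and let $\hat\mu=g_\theta\#\pi(e\mid\mathbf e,\phi)$ be the generated distribution on $\mathcal X$: the law of $g_\theta(e_J)$ for $J\sim\pi(\cdot\mid\mathbf e,\phi)$. Then $$\mathbb E_S\,\mathbb E_{q(\mathbf e,\phi,\theta\mid S)}W_2^2(\mathcal D,\hat\mu)\le\frac{2\Delta}{\sqrt n}+\mathbb E_S\,\mathbb E_{q(\mathbf e,\phi,\theta\mid S)}\Bigg[\frac2n\sum_{m=1}^n\mathbb E_{q(J_m\mid\mathbf e,\phi,S_m)}\,l\big(S_m,g_\theta(e_{J_m})\big)+4\Delta\sqrt{\frac2n\sum_{m=1}^n\mathrm{KL}\big(q(J_m\mid\mathbf e,\phi,S_m)\,\big\|\,\pi(J\mid\mathbf e,\phi)\big)}\Bigg],$$ where $W_2(\mu,\nu)=\big(\inf_\rho\int\|x-x'\|^2\,d\rho(x,x')\big)^{1/2}$, with the infimum over all couplings $\rho$ of $\mu$ and $\nu$, and the right-hand side may be $+\infty$. -/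

import Mathlib

open MeasureTheory ProbabilityTheory
open scoped ENNReal

namespace VQVAE

/-- The couplings of `μ` and `ν`: measures on the product with marginals `μ` and `ν`. -/
def couplings {E : Type*} [MeasurableSpace E] (μ ν : Measure E) : Set (Measure (E × E)) :=
  {ρ | ρ.map Prod.fst = μ ∧ ρ.map Prod.snd = ν}

/-- The 2-Wasserstein distance
`W₂(μ, ν) = (inf over couplings ρ of ∫ d(x, x')² dρ(x, x')) ^ (1/2)`. -/
noncomputable def W2 {E : Type*} [PseudoEMetricSpace E] [MeasurableSpace E]
    (μ ν : Measure E) : ℝ≥0∞ :=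
  (⨅ ρ ∈ couplings μ ν, ∫⁻ p, edist p.1 p.2 ^ 2 ∂ρ) ^ (1 / 2 : ℝ)

variable {d dz dφ dθ : ℕ}

/-- The squared Euclidean reconstruction loss `l(x, y) = ‖x - y‖²`. -/
noncomputable def loss {𝒳 : Set (EuclideanSpace ℝ (Fin d))} (x y : 𝒳) : ℝ :=
  ‖(x : EuclideanSpace ℝ (Fin d)) - (y : EuclideanSpace ℝ (Fin d))‖ ^ 2

/-- The parameters `w = (e, φ, θ)`: a codebook `e` of `K` points of the latent space `𝒵`, an
encoder parameter `φ` and a decoder parameter `θ`. -/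
abbrev Params (K : ℕ) (𝒵 : Set (EuclideanSpace ℝ (Fin dz))) (Φ : Set (EuclideanSpace ℝ (Fin dφ)))
    (Θ : Set (EuclideanSpace ℝ (Fin dθ))) : Type :=
  (Fin K → 𝒵) × Φ × Θ

/-- The expected reconstruction loss `l₀(w, x) = E_{q(J | e, φ, x)} l(x, g_θ(e_J))` of the
parameters `w = (e, φ, θ)` at the data point `x`, for the posterior `q` on the latent index. -/
noncomputable def expectedLoss {K : ℕ} {𝒳 : Set (EuclideanSpace ℝ (Fin d))}
    {𝒵 : Set (EuclideanSpace ℝ (Fin dz))} {Φ : Set (EuclideanSpace ℝ (Fin dφ))}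
    {Θ : Set (EuclideanSpace ℝ (Fin dθ))} (g : Θ → 𝒵 → 𝒳)
    (q : Kernel (((Fin K → 𝒵) × Φ) × 𝒳) (Fin K)) (w : Params K 𝒵 Φ Θ) (x : 𝒳) : ℝ≥0∞ :=
  ∫⁻ j, ENNReal.ofReal (loss x (g w.2.2 (w.1 j))) ∂(q ((w.1, w.2.1), x))

/-- The generated distribution `μ̂ = g_θ # π(e | e, φ)`: the prior `π(J | e, φ)` on the latent index,
carried to the latent space by `j ↦ e_j`, and pushed forward by the decoder `g_θ`. -/
noncomputable def generated {K : ℕ} {𝒳 : Set (EuclideanSpace ℝ (Fin d))}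
    {𝒵 : Set (EuclideanSpace ℝ (Fin dz))} {Φ : Set (EuclideanSpace ℝ (Fin dφ))}
    {Θ : Set (EuclideanSpace ℝ (Fin dθ))} (g : Θ → 𝒵 → 𝒳)
    (π : Kernel ((Fin K → 𝒵) × Φ) (Fin K)) (w : Params K 𝒵 Φ Θ) : Measure 𝒳 :=
  ((π (w.1, w.2.1)).map w.1).map (g w.2.2)

end VQVAE

/-!
The independent coupling bounds `W₂(𝒟, μ̂)²` by the mean squared distance `∬ ‖x - y‖² d𝒟(x) dμ̂(y)`.
Centre the data at the mean of `𝒟` and replace `𝒟` by the empirical measure of `S`. The expansion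
`‖x - y‖² = ‖x‖² + ‖y‖² - 2⟪x, y⟫` splits the change into a difference of second moments, which
does not involve `μ̂` and has zero expectation, and an inner product with the empirical mean, which
is at most `2√Δ` times the norm of that mean whatever `μ̂` is, even though `μ̂` depends on `S`. By
Bienaymé's identity this norm has expectation at most `√Δ / √n`. Passing from the prior to the
posterior on the latent index costs a weak form of Pinsker's inequality, a consequence of
`(1 - √t)² ≤ t log t + 1 - t` and of Jensen's inequality.
-/

namespace VQVAE

open InformationTheory
open scoped RealInnerProductSpace

section EmpiricalMeasure

variable {α : Type*} [MeasurableSpace α] {n : ℕ}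

/-- The empirical measure `n⁻¹ ∑ δ_{S m}` of a sample `S` of size `n`. For `n = 0` it is `0`. -/
noncomputable def empiricalMeasure (S : Fin n → α) : Measure α :=
  (n : ℝ≥0∞)⁻¹ • ∑ m, Measure.dirac (S m)

lemma lintegral_empiricalMeasure (S : Fin n → α) {f : α → ℝ≥0∞} (hf : Measurable f) :
    ∫⁻ x, f x ∂(empiricalMeasure S) = (n : ℝ≥0∞)⁻¹ * ∑ m, f (S m) := by
  simp [empiricalMeasure, lintegral_finsetSum_measure, lintegral_dirac' _ hf]

lemma measurable_lintegral_empiricalMeasure {f : α → ℝ≥0∞} (hf : Measurable f) :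
    Measurable fun S : Fin n → α => ∫⁻ x, f x ∂(empiricalMeasure S) := by
  simp_rw [lintegral_empiricalMeasure _ hf]
  fun_prop

instance [NeZero n] (S : Fin n → α) : IsProbabilityMeasure (empiricalMeasure S) where
  measure_univ := by
    simp [empiricalMeasure, ENNReal.inv_mul_cancel (NeZero.ne (n : ℝ≥0∞))]

lemma lintegral_lintegral_empiricalMeasure [NeZero n] (μ : Measure α) [IsProbabilityMeasure μ]
    {f : α → ℝ≥0∞} (hf : Measurable f) :
    ∫⁻ S, ∫⁻ x, f x ∂(empiricalMeasure S) ∂(Measure.pi fun _ : Fin n => μ) = ∫⁻ x, f x ∂μ := by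
  have heval (m : Fin n) : ∫⁻ S, f (S m) ∂(Measure.pi fun _ : Fin n => μ) = ∫⁻ x, f x ∂μ :=
    (measurePreserving_eval (fun _ : Fin n => μ) m).lintegral_comp hf
  simp_rw [lintegral_empiricalMeasure _ hf]
  rw [lintegral_const_mul _ (by fun_prop), lintegral_finsetSum _ fun m _ => by fun_prop]
  simp only [heval, Finset.sum_const, Finset.card_univ, Fintype.card_fin, nsmul_eq_mul]
  rw [← mul_assoc, ENNReal.inv_mul_cancel (NeZero.ne _) (ENNReal.natCast_ne_top n), one_mul]

variable {E : Type*} [NormedAddCommGroup E] [NormedSpace ℝ E] [CompleteSpace E]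

lemma integral_empiricalMeasure (S : Fin n → α) {f : α → E} (hf : StronglyMeasurable f) :
    ∫ x, f x ∂(empiricalMeasure S) = (n : ℝ)⁻¹ • ∑ m, f (S m) := by
  have hint : ∀ m ∈ Finset.univ, Integrable f (Measure.dirac (S m)) := fun m _ =>
    integrable_dirac' hf (by simp)
  simp [empiricalMeasure, integral_finsetSum_measure hint, integral_dirac' _ _ hf]

lemma stronglyMeasurable_integral_empiricalMeasure {f : α → E} (hf : StronglyMeasurable f) :
    StronglyMeasurable fun S : Fin n → α => ∫ x, f x ∂(empiricalMeasure S) := by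
  simp_rw [integral_empiricalMeasure _ hf]
  exact (Finset.stronglyMeasurable_fun_sum _ fun m _ =>
    hf.comp_measurable (measurable_pi_apply m)).const_smul _

lemma memLp_integral_empiricalMeasure {μ : Measure α} [IsProbabilityMeasure μ] {f : α → E}
    (hfm : StronglyMeasurable f) {p : ℝ≥0∞} (hf : MemLp f p μ) :
    MemLp (fun S => ∫ x, f x ∂(empiricalMeasure S)) p (Measure.pi fun _ : Fin n => μ) := by
  simp_rw [integral_empiricalMeasure _ hfm]
  exact (memLp_finsetSum _ fun m _ =>
    hf.comp_measurePreserving (measurePreserving_eval (fun _ : Fin n => μ) m)).const_smul _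

end EmpiricalMeasure

section KullbackLeibler

lemma sq_one_sub_sqrt_le_klFun {t : ℝ} (ht : 0 ≤ t) : (1 - √t) ^ 2 ≤ klFun t := by
  rcases ht.eq_or_lt with rfl | ht
  · simp [klFun_zero]
  have hlog : 1 - (√t)⁻¹ ≤ Real.log t / 2 := by
    simpa only [Real.log_sqrt ht.le] using Real.one_sub_inv_le_log_of_pos (Real.sqrt_pos.2 ht)
  have hsqrt : t * (√t)⁻¹ = √t := by rw [← div_eq_mul_inv, Real.div_sqrt]
  calc (1 - √t) ^ 2 = 2 * (t * (1 - (√t)⁻¹)) + 1 - t := by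
        rw [mul_sub, hsqrt, sub_sq, Real.sq_sqrt ht.le]; ring
    _ ≤ 2 * (t * (Real.log t / 2)) + 1 - t := by gcongr
    _ = klFun t := by rw [klFun_apply]; ring

lemma one_le_add_two_mul_sqrt_klFun {t : ℝ} (ht : 0 ≤ t) : 1 ≤ t + 2 * √(klFun t) := by
  have h : 1 - √t ≤ √(klFun t) := Real.le_sqrt_of_sq_le (sq_one_sub_sqrt_le_klFun ht)
  nlinarith [Real.sq_sqrt ht, sq_nonneg (1 - √t)]

lemma one_le_add_two_mul_rpow_ofReal_klFun {t : ℝ≥0∞} (ht : t ≠ ∞) :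
    1 ≤ t + 2 * ENNReal.ofReal (klFun t.toReal) ^ (1 / 2 : ℝ) := by
  have h := ENNReal.ofReal_le_ofReal (one_le_add_two_mul_sqrt_klFun (t.toReal_nonneg))
  rwa [ENNReal.ofReal_one, ENNReal.ofReal_add t.toReal_nonneg (by positivity),
    ENNReal.ofReal_toReal ht, ENNReal.ofReal_mul zero_le_two, ENNReal.ofReal_ofNat,
    Real.sqrt_eq_rpow, ← ENNReal.ofReal_rpow_of_nonneg (klFun_nonneg t.toReal_nonneg)
      one_half_pos.le] at h

variable {α : Type*} [MeasurableSpace α]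

lemma lintegral_rpow_le_rpow_lintegral (μ : Measure α) [IsProbabilityMeasure μ] {f : α → ℝ≥0∞}
    (hf : AEMeasurable f μ) {p : ℝ} (hp₀ : 0 < p) (hp₁ : p ≤ 1) :
    ∫⁻ x, f x ^ p ∂μ ≤ (∫⁻ x, f x ∂μ) ^ p := by
  have h := eLpNorm'_le_eLpNorm'_of_exponent_le hp₀ hp₁ μ hf.aestronglyMeasurable
  simpa [eLpNorm'_eq_lintegral_enorm, ← ENNReal.rpow_mul, hp₀.ne'] using
    ENNReal.rpow_le_rpow h hp₀.le

lemma arith_mean_rpow_le_rpow_arith_mean {n : ℕ} [NeZero n] (z : Fin n → ℝ≥0∞) {p : ℝ}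
    (hp₀ : 0 < p) (hp₁ : p ≤ 1) :
    (n : ℝ≥0∞)⁻¹ * ∑ m, z m ^ p ≤ ((n : ℝ≥0∞)⁻¹ * ∑ m, z m) ^ p := by
  have h := lintegral_rpow_le_rpow_lintegral (empiricalMeasure (id : Fin n → Fin n))
    (measurable_of_finite z).aemeasurable hp₀ hp₁
  simpa only [lintegral_empiricalMeasure _ (measurable_of_finite _), id_eq] using h

lemma lintegral_le_lintegral_add_mul_rpow_klDiv (μ ν : Measure α) [IsProbabilityMeasure μ]
    [IsProbabilityMeasure ν] {f : α → ℝ≥0∞} (hf : Measurable f) {C : ℝ≥0∞} (hC : ∀ x, f x ≤ C) :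
    ∫⁻ x, f x ∂ν ≤ ∫⁻ x, f x ∂μ + 2 * C * klDiv μ ν ^ (1 / 2 : ℝ) := by
  rcases eq_or_ne C 0 with rfl | hC₀
  · simp [nonpos_iff_eq_zero.1 (hC _)]
  by_cases hac : μ ≪ ν
  swap
  · simp [klDiv_of_not_ac hac, hC₀]
  set k : α → ℝ≥0∞ := fun x => ENNReal.ofReal (klFun (μ.rnDeriv ν x).toReal)
  have hk : Measurable k := by fun_prop
  have hpointwise : ∀ᵐ x ∂ν, f x ≤ μ.rnDeriv ν x * f x + 2 * C * k x ^ (1 / 2 : ℝ) := by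
    filter_upwards [μ.rnDeriv_lt_top ν] with x hx
    calc f x ≤ (μ.rnDeriv ν x + 2 * k x ^ (1 / 2 : ℝ)) * f x :=
          le_mul_of_one_le_left' (one_le_add_two_mul_rpow_ofReal_klFun hx.ne)
      _ = μ.rnDeriv ν x * f x + 2 * f x * k x ^ (1 / 2 : ℝ) := by ring
      _ ≤ μ.rnDeriv ν x * f x + 2 * C * k x ^ (1 / 2 : ℝ) := by gcongr; exact hC x
  calc ∫⁻ x, f x ∂ν ≤ ∫⁻ x, (μ.rnDeriv ν x * f x + 2 * C * k x ^ (1 / 2 : ℝ)) ∂ν :=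
        lintegral_mono_ae hpointwise
    _ = ∫⁻ x, f x ∂μ + 2 * C * ∫⁻ x, k x ^ (1 / 2 : ℝ) ∂ν := by
        rw [lintegral_add_left (by fun_prop), lintegral_rnDeriv_mul hac hf.aemeasurable,
          lintegral_const_mul _ (by fun_prop)]
    _ ≤ ∫⁻ x, f x ∂μ + 2 * C * (∫⁻ x, k x ∂ν) ^ (1 / 2 : ℝ) := by
        gcongr
        exact lintegral_rpow_le_rpow_lintegral ν hk.aemeasurable (by norm_num) (by norm_num)
    _ = ∫⁻ x, f x ∂μ + 2 * C * klDiv μ ν ^ (1 / 2 : ℝ) := by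
        rw [klDiv_eq_lintegral_klFun_of_ac hac]

lemma arith_mean_lintegral_le_add_mul_rpow_arith_mean_klDiv {n : ℕ} [NeZero n]
    (μ : Fin n → Measure α) [∀ m, IsProbabilityMeasure (μ m)] (ν : Measure α)
    [IsProbabilityMeasure ν] {f : Fin n → α → ℝ≥0∞} (hf : ∀ m, Measurable (f m)) {C : ℝ≥0∞}
    (hC : ∀ m x, f m x ≤ C) :
    (n : ℝ≥0∞)⁻¹ * ∑ m, ∫⁻ x, f m x ∂ν ≤
      (n : ℝ≥0∞)⁻¹ * ∑ m, ∫⁻ x, f m x ∂(μ m) +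
        2 * C * ((n : ℝ≥0∞)⁻¹ * ∑ m, klDiv (μ m) ν) ^ (1 / 2 : ℝ) := by
  calc (n : ℝ≥0∞)⁻¹ * ∑ m, ∫⁻ x, f m x ∂ν
      ≤ (n : ℝ≥0∞)⁻¹ *
          ∑ m, (∫⁻ x, f m x ∂(μ m) + 2 * C * klDiv (μ m) ν ^ (1 / 2 : ℝ)) := by
        gcongr with m
        exact lintegral_le_lintegral_add_mul_rpow_klDiv (μ m) ν (hf m) (hC m)
    _ = (n : ℝ≥0∞)⁻¹ * ∑ m, ∫⁻ x, f m x ∂(μ m) +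
          2 * C * ((n : ℝ≥0∞)⁻¹ * ∑ m, klDiv (μ m) ν ^ (1 / 2 : ℝ)) := by
        rw [Finset.sum_add_distrib, ← Finset.mul_sum]
        ring
    _ ≤ _ := by
        gcongr
        exact arith_mean_rpow_le_rpow_arith_mean _ (by norm_num) (by norm_num)

end KullbackLeibler

section Hilbert

variable {Ω Ω' E : Type*} [MeasurableSpace Ω] [MeasurableSpace Ω'] [NormedAddCommGroup E]

lemma lintegral_enorm_sq_eq_ofReal_integral_norm_sq {μ : Measure Ω} {X : Ω → E}
    (hX : MemLp X 2 μ) : ∫⁻ ω, ‖X ω‖ₑ ^ 2 ∂μ = ENNReal.ofReal (∫ ω, ‖X ω‖ ^ 2 ∂μ) := by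
  rw [ofReal_integral_eq_lintegral_ofReal (hX.integrable_norm_pow two_ne_zero)
    (.of_forall fun _ => by positivity)]
  simp_rw [ENNReal.ofReal_pow (norm_nonneg _), ofReal_norm]

variable [InnerProductSpace ℝ E]

lemma integrable_inner_of_memLp_two {μ : Measure Ω} {X Y : Ω → E} (hX : MemLp X 2 μ)
    (hY : MemLp Y 2 μ) : Integrable (fun ω => ⟪X ω, Y ω⟫) μ :=
  memLp_one_iff_integrable.1 ((innerSL ℝ).memLp_of_bilin 1 hX hY)

variable [CompleteSpace E]

lemma integral_norm_sub_sq_prod {μ : Measure Ω} {ν : Measure Ω'} [IsProbabilityMeasure μ]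
    [IsProbabilityMeasure ν] {X : Ω → E} {Y : Ω' → E} (hX : MemLp X 2 μ) (hY : MemLp Y 2 ν) :
    ∫ p, ‖X p.1 - Y p.2‖ ^ 2 ∂(μ.prod ν) =
      ∫ ω, ‖X ω‖ ^ 2 ∂μ + ∫ ω, ‖Y ω‖ ^ 2 ∂ν - 2 * ⟪∫ ω, X ω ∂μ, ∫ ω, Y ω ∂ν⟫ := by
  have hX₁ : MemLp (fun p : Ω × Ω' => X p.1) 2 (μ.prod ν) := hX.comp_fst ν
  have hY₂ : MemLp (fun p : Ω × Ω' => Y p.2) 2 (μ.prod ν) := hY.comp_snd μ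
  have hXX : Integrable (fun p : Ω × Ω' => ‖X p.1‖ ^ 2) (μ.prod ν) :=
    hX₁.integrable_norm_pow two_ne_zero
  have hYY : Integrable (fun p : Ω × Ω' => ‖Y p.2‖ ^ 2) (μ.prod ν) :=
    hY₂.integrable_norm_pow two_ne_zero
  have hXY : Integrable (fun p : Ω × Ω' => 2 * ⟪X p.1, Y p.2⟫) (μ.prod ν) :=
    (integrable_inner_of_memLp_two hX₁ hY₂).const_mul 2
  have hinner : ∫ p, ⟪X p.1, Y p.2⟫ ∂(μ.prod ν) = ⟪∫ ω, X ω ∂μ, ∫ ω, Y ω ∂ν⟫ :=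
    integral_prod_bilin (innerSL ℝ) (hX.integrable one_le_two) (hY.integrable one_le_two)
  calc ∫ p, ‖X p.1 - Y p.2‖ ^ 2 ∂(μ.prod ν)
      = ∫ p, (‖X p.1‖ ^ 2 + ‖Y p.2‖ ^ 2 - 2 * ⟪X p.1, Y p.2⟫) ∂(μ.prod ν) := by
        simp_rw [norm_sub_sq_real, sub_add_eq_add_sub]
    _ = _ := by
        rw [integral_sub (by fun_prop) hXY, integral_add hXX hYY, integral_const_mul, hinner,
          integral_fun_fst fun ω => ‖X ω‖ ^ 2, integral_fun_snd fun ω => ‖Y ω‖ ^ 2]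
        simp only [probReal_univ, one_smul]

lemma integral_norm_sum_sq_of_pairwise_indepFun [MeasurableSpace E] [BorelSpace E] {ι : Type*}
    [Fintype ι] {μ : Measure Ω} [IsFiniteMeasure μ] {X : ι → Ω → E} (hX : ∀ i, MemLp (X i) 2 μ)
    (hindep : Pairwise fun i j => X i ⟂ᵢ[μ] X j) (hzero : ∀ i, ∫ ω, X i ω ∂μ = 0) :
    ∫ ω, ‖∑ i, X i ω‖ ^ 2 ∂μ = ∑ i, ∫ ω, ‖X i ω‖ ^ 2 ∂μ := by
  have horth {i j : ι} (hij : j ≠ i) : ∫ ω, ⟪X i ω, X j ω⟫ ∂μ = 0 := by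
    have h := (hindep hij.symm).integral_bilin ((hX i).integrable one_le_two)
      ((hX j).integrable one_le_two) (innerSL ℝ)
    rwa [hzero, map_zero, zero_apply] at h
  have hint (i j : ι) : Integrable (fun ω => ⟪X i ω, X j ω⟫) μ :=
    integrable_inner_of_memLp_two (hX i) (hX j)
  simp_rw [← real_inner_self_eq_norm_sq, sum_inner, inner_sum]
  rw [integral_finsetSum _ fun i _ => integrable_finsetSum _ fun j _ => hint i j]
  refine Finset.sum_congr rfl fun i _ => ?_
  rw [integral_finsetSum _ fun j _ => hint i j]
  exact Finset.sum_eq_single i (fun j _ hij => horth hij) (by simp)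

section EmpiricalMean

variable {μ : Measure Ω} [IsProbabilityMeasure μ] {n : ℕ} {U : Ω → E}

lemma integral_norm_integral_empiricalMeasure_sq (hUm : StronglyMeasurable U) (hU : MemLp U 2 μ)
    (hzero : ∫ x, U x ∂μ = 0) :
    ∫ S, ‖∫ x, U x ∂(empiricalMeasure S)‖ ^ 2 ∂(Measure.pi fun _ : Fin n => μ) =
      (n : ℝ)⁻¹ * ∫ x, ‖U x‖ ^ 2 ∂μ := by
  borelize E
  have hindep : iIndepFun (fun m S => U (S m)) (Measure.pi fun _ : Fin n => μ) :=
    iIndepFun_pi fun _ => hUm.measurable.aemeasurable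
  have hmemLp (m : Fin n) : MemLp (fun S => U (S m)) 2 (Measure.pi fun _ : Fin n => μ) :=
    hU.comp_measurePreserving (measurePreserving_eval (fun _ : Fin n => μ) m)
  have heval (m : Fin n) :
      ∫ S, ‖U (S m)‖ ^ 2 ∂(Measure.pi fun _ : Fin n => μ) = ∫ x, ‖U x‖ ^ 2 ∂μ :=
    integral_comp_eval (μ := fun _ : Fin n => μ) (f := fun x => ‖U x‖ ^ 2) (hU.1.norm.pow 2)
  have hsum : ∫ S, ‖∑ m, U (S m)‖ ^ 2 ∂(Measure.pi fun _ : Fin n => μ) =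
      n * ∫ x, ‖U x‖ ^ 2 ∂μ := by
    rw [integral_norm_sum_sq_of_pairwise_indepFun hmemLp (fun i j hij => hindep.indepFun hij)
      fun m => (integral_comp_eval hU.1).trans hzero]
    simp only [heval, Finset.sum_const, Finset.card_univ, Fintype.card_fin, nsmul_eq_mul]
  simp_rw [integral_empiricalMeasure _ hUm, norm_smul, mul_pow, integral_const_mul, hsum]
  rcases eq_or_ne n 0 with rfl | hn
  · simp
  · rw [norm_inv, Real.norm_natCast]
    field_simp

lemma lintegral_enorm_integral_empiricalMeasure_le (hUm : StronglyMeasurable U) {R : ℝ}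
    (hR : 0 ≤ R) (hbound : ∀ x, ‖U x‖ ≤ R) (hzero : ∫ x, U x ∂μ = 0) :
    ∫⁻ S, ‖∫ x, U x ∂(empiricalMeasure S)‖ₑ ∂(Measure.pi fun _ : Fin n => μ) ≤
      ENNReal.ofReal (R / √n) := by
  have hU : MemLp U 2 μ := .of_bound hUm.aestronglyMeasurable R (.of_forall hbound)
  have hV := memLp_integral_empiricalMeasure (n := n) hUm hU
  have hsq : ∫ x, ‖U x‖ ^ 2 ∂μ ≤ R ^ 2 := by
    simpa using integral_mono (hU.integrable_norm_pow two_ne_zero) (integrable_const (R ^ 2))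
      fun x => pow_le_pow_left₀ (norm_nonneg _) (hbound x) 2
  calc ∫⁻ S, ‖∫ x, U x ∂(empiricalMeasure S)‖ₑ ∂(Measure.pi fun _ : Fin n => μ)
      ≤ eLpNorm (fun S => ∫ x, U x ∂(empiricalMeasure S)) 2 (Measure.pi fun _ : Fin n => μ) := by
        rw [← eLpNorm_one_eq_lintegral_enorm]
        exact eLpNorm_le_eLpNorm_of_exponent_le one_le_two hV.1
    _ = ENNReal.ofReal √((n : ℝ)⁻¹ * ∫ x, ‖U x‖ ^ 2 ∂μ) := by
        rw [hV.eLpNorm_eq_integral_rpow_norm two_ne_zero ENNReal.ofNat_ne_top,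
          ← integral_norm_integral_empiricalMeasure_sq hUm hU hzero, Real.sqrt_eq_rpow]
        norm_num
    _ ≤ ENNReal.ofReal √((n : ℝ)⁻¹ * R ^ 2) := by gcongr
    _ = ENNReal.ofReal (R / √n) := by
        rw [Real.sqrt_mul (by positivity), Real.sqrt_inv, Real.sqrt_sq hR, div_eq_inv_mul]

end EmpiricalMean

end Hilbert

section MeanSqDist

/-- The mean squared distance of independent points of laws `μ` and `ν`, that is, the quadratic
transport cost of the independent coupling of `μ` and `ν`. -/
noncomputable def meanSqDist {α : Type*} [PseudoEMetricSpace α] [MeasurableSpace α]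
    (μ ν : Measure α) : ℝ≥0∞ :=
  ∫⁻ p, edist p.1 p.2 ^ 2 ∂(μ.prod ν)

lemma W2_sq_le_meanSqDist {α : Type*} [PseudoEMetricSpace α] [MeasurableSpace α]
    (μ ν : Measure α) [IsProbabilityMeasure μ] [IsProbabilityMeasure ν] :
    W2 μ ν ^ 2 ≤ meanSqDist μ ν := by
  have hprod : μ.prod ν ∈ couplings μ ν := by simp [couplings]
  rw [W2, ← ENNReal.rpow_natCast, ← ENNReal.rpow_mul, Nat.cast_ofNat,
    one_div_mul_cancel two_ne_zero, ENNReal.rpow_one]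
  exact iInf₂_le _ hprod

lemma meanSqDist_empiricalMeasure_map {α β : Type*} [PseudoEMetricSpace α]
    [SecondCountableTopology α] [MeasurableSpace α] [OpensMeasurableSpace α] [MeasurableSpace β]
    {n : ℕ} (S : Fin n → α) (ν : Measure β) [SFinite ν] {f : β → α} (hf : Measurable f) :
    meanSqDist (empiricalMeasure S) (ν.map f) =
      (n : ℝ≥0∞)⁻¹ * ∑ m, ∫⁻ y, edist (S m) (f y) ^ 2 ∂ν := by
  have hedist : Measurable fun p : α × α => edist p.1 p.2 ^ 2 := by fun_prop
  rw [meanSqDist, lintegral_prod _ hedist.aemeasurable,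
    lintegral_empiricalMeasure S hedist.lintegral_prod_right']
  congr! 2 with m
  exact lintegral_map (hedist.comp measurable_prodMk_left) hf

section Isometry

variable {α E : Type*} [PseudoEMetricSpace α] [SecondCountableTopology α] [MeasurableSpace α]
  [OpensMeasurableSpace α] [NormedAddCommGroup E] [InnerProductSpace ℝ E] [CompleteSpace E]
  {U : α → E} {R : ℝ} {μ : Measure α} [IsProbabilityMeasure μ]

lemma meanSqDist_eq_ofReal_of_isometry (hU : Isometry U) (hbound : ∀ x, ‖U x‖ ≤ R)
    (ν : Measure α) [IsProbabilityMeasure ν] :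
    meanSqDist μ ν = ENNReal.ofReal
      (∫ x, ‖U x‖ ^ 2 ∂μ + ∫ x, ‖U x‖ ^ 2 ∂ν - 2 * ⟪∫ x, U x ∂μ, ∫ x, U x ∂ν⟫) := by
  have hmemLp (ρ : Measure α) [IsProbabilityMeasure ρ] : MemLp U 2 ρ :=
    .of_bound hU.continuous.aestronglyMeasurable R (.of_forall hbound)
  have hsub : MemLp (fun p : α × α => U p.1 - U p.2) 2 (μ.prod ν) :=
    ((hmemLp μ).comp_fst ν).sub ((hmemLp ν).comp_snd μ)
  rw [← integral_norm_sub_sq_prod (hmemLp μ) (hmemLp ν),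
    ← lintegral_enorm_sq_eq_ofReal_integral_norm_sq hsub, meanSqDist]
  simp_rw [← hU.edist_eq, edist_eq_enorm_sub]

lemma meanSqDist_add_le_of_isometry (hU : Isometry U) (hbound : ∀ x, ‖U x‖ ≤ R)
    (hzero : ∫ x, U x ∂μ = 0) (μ' ν : Measure α) [IsProbabilityMeasure μ']
    [IsProbabilityMeasure ν] :
    meanSqDist μ ν + ∫⁻ x, ‖U x‖ₑ ^ 2 ∂μ' ≤
      meanSqDist μ' ν + (∫⁻ x, ‖U x‖ₑ ^ 2 ∂μ + ENNReal.ofReal (2 * R) * ‖∫ x, U x ∂μ'‖ₑ) := by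
  have hR : 0 ≤ R := let ⟨x⟩ := nonempty_of_isProbabilityMeasure μ; (norm_nonneg _).trans (hbound x)
  have hinner : ⟪∫ x, U x ∂μ', ∫ x, U x ∂ν⟫ ≤ R * ‖∫ x, U x ∂μ'‖ := by
    have hν : ‖∫ x, U x ∂ν‖ ≤ R := by
      simpa using norm_integral_le_of_norm_le_const (μ := ν) (.of_forall hbound)
    calc _ ≤ ‖∫ x, U x ∂μ'‖ * ‖∫ x, U x ∂ν‖ := real_inner_le_norm _ _
      _ ≤ R * ‖∫ x, U x ∂μ'‖ := by rw [mul_comm]; gcongr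
  have hsecond (ρ : Measure α) [IsProbabilityMeasure ρ] :
      ∫⁻ x, ‖U x‖ₑ ^ 2 ∂ρ = ENNReal.ofReal (∫ x, ‖U x‖ ^ 2 ∂ρ) :=
    lintegral_enorm_sq_eq_ofReal_integral_norm_sq
      (.of_bound hU.continuous.aestronglyMeasurable R (.of_forall hbound))
  rw [meanSqDist_eq_ofReal_of_isometry hU hbound, meanSqDist_eq_ofReal_of_isometry hU hbound,
    hzero, inner_zero_left, mul_zero, sub_zero, hsecond, hsecond, ← ofReal_norm,
    ← ENNReal.ofReal_mul (by positivity), ← ENNReal.ofReal_add (by positivity) (by positivity),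
    ← ENNReal.ofReal_add (by positivity) (by positivity)]
  refine (ENNReal.ofReal_le_ofReal ?_).trans ENNReal.ofReal_add_le
  linarith

lemma lintegral_meanSqDist_add_le_of_isometry {W : Type*} [MeasurableSpace W] (hU : Isometry U)
    (hbound : ∀ x, ‖U x‖ ≤ R) (hzero : ∫ x, U x ∂μ = 0) (μ' : Measure α)
    [IsProbabilityMeasure μ'] (ρ : Measure W) [IsProbabilityMeasure ρ] (ν : W → Measure α)
    [∀ w, IsProbabilityMeasure (ν w)] :
    ∫⁻ w, meanSqDist μ (ν w) ∂ρ + ∫⁻ x, ‖U x‖ₑ ^ 2 ∂μ' ≤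
      ∫⁻ w, meanSqDist μ' (ν w) ∂ρ +
        (∫⁻ x, ‖U x‖ₑ ^ 2 ∂μ + ENNReal.ofReal (2 * R) * ‖∫ x, U x ∂μ'‖ₑ) := by
  simpa [lintegral_add_right _ measurable_const] using lintegral_mono (μ := ρ) fun w =>
    meanSqDist_add_le_of_isometry hU hbound hzero μ' (ν w)

lemma lintegral_lintegral_meanSqDist_le {W : Type*} [MeasurableSpace W] {n : ℕ} [NeZero n]
    (hU : Isometry U) (hbound : ∀ x, ‖U x‖ ≤ R) (hzero : ∫ x, U x ∂μ = 0)
    (κ : Kernel (Fin n → α) W) [IsMarkovKernel κ] (ν : W → Measure α)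
    [∀ w, IsProbabilityMeasure (ν w)] :
    ∫⁻ S, ∫⁻ w, meanSqDist μ (ν w) ∂(κ S) ∂(Measure.pi fun _ : Fin n => μ) ≤
      ENNReal.ofReal (2 * R ^ 2 / √n) +
        ∫⁻ S, ∫⁻ w, meanSqDist (empiricalMeasure S) (ν w) ∂(κ S)
          ∂(Measure.pi fun _ : Fin n => μ) := by
  have hR : 0 ≤ R := let ⟨x⟩ := nonempty_of_isProbabilityMeasure μ; (norm_nonneg _).trans (hbound x)
  have hUm : StronglyMeasurable U := hU.continuous.stronglyMeasurable
  have hsq : Measurable fun x => ‖U x‖ₑ ^ 2 := hUm.enorm.pow_const 2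
  have hmean : Measurable fun S : Fin n → α => ‖∫ x, U x ∂(empiricalMeasure S)‖ₑ :=
    (stronglyMeasurable_integral_empiricalMeasure hUm).enorm
  have hfinite : ∫⁻ x, ‖U x‖ₑ ^ 2 ∂μ ≠ ∞ := by
    rw [lintegral_enorm_sq_eq_ofReal_integral_norm_sq
      (.of_bound hUm.aestronglyMeasurable R (.of_forall hbound))]
    exact ENNReal.ofReal_ne_top
  set P := Measure.pi fun _ : Fin n => μ
  refine ENNReal.le_of_add_le_add_right hfinite ?_
  calc ∫⁻ S, ∫⁻ w, meanSqDist μ (ν w) ∂(κ S) ∂P + ∫⁻ x, ‖U x‖ₑ ^ 2 ∂μ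
      = ∫⁻ S, (∫⁻ w, meanSqDist μ (ν w) ∂(κ S) + ∫⁻ x, ‖U x‖ₑ ^ 2 ∂(empiricalMeasure S)) ∂P := by
        rw [lintegral_add_right _ (measurable_lintegral_empiricalMeasure hsq),
          lintegral_lintegral_empiricalMeasure μ hsq]
    _ ≤ ∫⁻ S, (∫⁻ w, meanSqDist (empiricalMeasure S) (ν w) ∂(κ S) + (∫⁻ x, ‖U x‖ₑ ^ 2 ∂μ +
          ENNReal.ofReal (2 * R) * ‖∫ x, U x ∂(empiricalMeasure S)‖ₑ)) ∂P :=
        lintegral_mono fun S =>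
          lintegral_meanSqDist_add_le_of_isometry hU hbound hzero (empiricalMeasure S) (κ S) ν
    _ = ∫⁻ S, ∫⁻ w, meanSqDist (empiricalMeasure S) (ν w) ∂(κ S) ∂P + (∫⁻ x, ‖U x‖ₑ ^ 2 ∂μ +
          ENNReal.ofReal (2 * R) * ∫⁻ S, ‖∫ x, U x ∂(empiricalMeasure S)‖ₑ ∂P) := by
        rw [lintegral_add_right _ (by fun_prop), lintegral_add_left measurable_const,
          lintegral_const_mul _ hmean, lintegral_const, measure_univ, mul_one]
    _ ≤ ∫⁻ S, ∫⁻ w, meanSqDist (empiricalMeasure S) (ν w) ∂(κ S) ∂P + (∫⁻ x, ‖U x‖ₑ ^ 2 ∂μ +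
          ENNReal.ofReal (2 * R) * ENNReal.ofReal (R / √n)) := by
        gcongr
        exact lintegral_enorm_integral_empiricalMeasure_le hUm hR hbound hzero
    _ = ENNReal.ofReal (2 * R ^ 2 / √n) +
          ∫⁻ S, ∫⁻ w, meanSqDist (empiricalMeasure S) (ν w) ∂(κ S) ∂P + ∫⁻ x, ‖U x‖ₑ ^ 2 ∂μ := by
        rw [← ENNReal.ofReal_mul (by positivity), mul_div_assoc', mul_assoc 2 R R, ← sq]
        ring

end Isometry

end MeanSqDist

section Centering

variable {α E : Type*} [MeasurableSpace α] [NormedAddCommGroup E] [NormedSpace ℝ E]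
  [CompleteSpace E]

lemma norm_sub_integral_le {μ : Measure α} [IsProbabilityMeasure μ] {f : α → E}
    (hf : Integrable f μ) {R : ℝ} (a : α) (hR : ∀ x, ‖f a - f x‖ ≤ R) :
    ‖f a - ∫ x, f x ∂μ‖ ≤ R := by
  have h : f a - ∫ x, f x ∂μ = ∫ x, (f a - f x) ∂μ := by
    rw [integral_sub (integrable_const _) hf, integral_const, probReal_univ, one_smul]
  simpa [h] using norm_integral_le_of_norm_le_const (μ := μ) (.of_forall hR)

lemma exists_isometry_norm_le_integral_eq_zero [PseudoEMetricSpace α] [OpensMeasurableSpace α]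
    [SecondCountableTopology α] {V : α → E} (hV : Isometry V) {R : ℝ} (hR : 0 ≤ R)
    (hdist : ∀ x y : α, edist x y ≤ ENNReal.ofReal R) (μ : Measure α) [IsProbabilityMeasure μ] :
    ∃ U : α → E, Isometry U ∧ (∀ x, ‖U x‖ ≤ R) ∧ ∫ x, U x ∂μ = 0 := by
  obtain ⟨x₀⟩ := nonempty_of_isProbabilityMeasure μ
  have hnorm (x y : α) : ‖V x - V y‖ ≤ R := by
    rw [← dist_eq_norm, ← edist_le_ofReal hR, hV.edist_eq]
    exact hdist x y
  have hint : Integrable V μ := .of_bound hV.continuous.aestronglyMeasurable (‖V x₀‖ + R) <|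
    .of_forall fun x => (norm_le_norm_add_norm_sub' _ _).trans (by gcongr; exact hnorm x x₀)
  refine ⟨fun x => V x - ∫ y, V y ∂μ, ?_, fun x => norm_sub_integral_le hint x (hnorm x), ?_⟩
  · exact fun x y => by rw [edist_sub_right, hV.edist_eq]
  · rw [integral_sub hint (integrable_const _), integral_const, probReal_univ, one_smul, sub_self]

end Centering

section Params

variable {d dz dφ dθ K : ℕ} {𝒳 : Set (EuclideanSpace ℝ (Fin d))}
  {𝒵 : Set (EuclideanSpace ℝ (Fin dz))} {Φ : Set (EuclideanSpace ℝ (Fin dφ))}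
  {Θ : Set (EuclideanSpace ℝ (Fin dθ))}

lemma generated_eq_map {g : Θ → 𝒵 → 𝒳} (hg : ∀ θ, Measurable (g θ))
    (π : Kernel ((Fin K → 𝒵) × Φ) (Fin K)) (w : Params K 𝒵 Φ Θ) :
    generated g π w = (π (w.1, w.2.1)).map fun j => g w.2.2 (w.1 j) :=
  Measure.map_map (hg _) (measurable_of_finite _)

lemma expectedLoss_eq_lintegral_edist_sq (g : Θ → 𝒵 → 𝒳)
    (q : Kernel (((Fin K → 𝒵) × Φ) × 𝒳) (Fin K)) (w : Params K 𝒵 Φ Θ) (x : 𝒳) :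
    expectedLoss g q w x = ∫⁻ j, edist x (g w.2.2 (w.1 j)) ^ 2 ∂(q ((w.1, w.2.1), x)) := by
  simp_rw [expectedLoss, loss, ENNReal.ofReal_pow (norm_nonneg _), ← dist_eq_norm,
    ← Subtype.dist_eq, ← edist_dist]

end Params

end VQVAE

open VQVAE InformationTheory in
theorem theorem5_general {E : Type*} [NormedAddCommGroup E] [InnerProductSpace ℝ E]
    [CompleteSpace E] [SecondCountableTopology E] [MeasurableSpace E] [BorelSpace E] {𝒳 : Set E}
    {W J : Type*} [MeasurableSpace W] [MeasurableSpace J] {n : ℕ} [NeZero n] {Δ : ℝ} (hΔ : 0 ≤ Δ)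
    (hdiam : Metric.ediam 𝒳 ≤ ENNReal.ofReal √Δ) (𝒟 : Measure 𝒳) [IsProbabilityMeasure 𝒟]
    (f : W → J → 𝒳) (hf : ∀ w, Measurable (f w))
    (alg : Kernel (Fin n → 𝒳) W) [IsMarkovKernel alg]
    (q : Kernel (W × 𝒳) J) [IsMarkovKernel q] (π : Kernel W J) [IsMarkovKernel π] :
    ∫⁻ S, ∫⁻ w, W2 𝒟 ((π w).map (f w)) ^ 2 ∂(alg S) ∂(Measure.pi fun _ : Fin n => 𝒟) ≤
      ENNReal.ofReal (2 * Δ / √n) +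
        ∫⁻ S, ∫⁻ w,
          ((n : ℝ≥0∞)⁻¹ * ∑ m, ∫⁻ j, edist (S m) (f w j) ^ 2 ∂(q (w, S m)) +
            2 * ENNReal.ofReal Δ *
              ((n : ℝ≥0∞)⁻¹ * ∑ m, klDiv (q (w, S m)) (π w)) ^ (1 / 2 : ℝ))
          ∂(alg S) ∂(Measure.pi fun _ : Fin n => 𝒟) := by
  have hedist (x y : 𝒳) : edist x y ≤ ENNReal.ofReal √Δ :=
    (Metric.edist_le_ediam_of_mem x.2 y.2).trans hdiam
  have hedist_sq (x y : 𝒳) : edist x y ^ 2 ≤ ENNReal.ofReal Δ := by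
    rw [← Real.sq_sqrt hΔ, ENNReal.ofReal_pow (Real.sqrt_nonneg Δ)]
    exact pow_le_pow_left' (hedist x y) 2
  obtain ⟨U, hU, hbound, hzero⟩ :=
    exists_isometry_norm_le_integral_eq_zero isometry_subtype_coe (Real.sqrt_nonneg Δ) hedist 𝒟
  have hgen (w : W) : IsProbabilityMeasure ((π w).map (f w)) :=
    Measure.isProbabilityMeasure_map (hf w).aemeasurable
  calc _ ≤ ∫⁻ S, ∫⁻ w, meanSqDist 𝒟 ((π w).map (f w)) ∂(alg S) ∂(Measure.pi fun _ => 𝒟) := by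
        gcongr
        exact W2_sq_le_meanSqDist _ _
    _ ≤ ENNReal.ofReal (2 * Δ / √n) + ∫⁻ S, ∫⁻ w,
          meanSqDist (empiricalMeasure S) ((π w).map (f w)) ∂(alg S) ∂(Measure.pi fun _ => 𝒟) := by
        simpa only [Real.sq_sqrt hΔ] using
          lintegral_lintegral_meanSqDist_le hU hbound hzero alg fun w => (π w).map (f w)
    _ ≤ _ := by
        gcongr with S w
        rw [meanSqDist_empiricalMeasure_map S _ (hf w)]
        exact arith_mean_lintegral_le_add_mul_rpow_arith_mean_klDiv _ _
          (fun m => by have := hf w; fun_prop) fun m j => hedist_sq _ _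

/-- `𝒟` is the data distribution on `𝒳`, `alg` the randomized learning algorithm
`q(e, φ, θ | S)`, `q` the posterior `q(J | e, φ, x)` on the latent indices, `π` the prior
`π(J | e, φ)`, and `g` the decoder. All quantities take values in `[0, ∞]`. -/
theorem theorem5 {d dz dφ dθ : ℕ} (K n : ℕ) (hn : 0 < n)
    (𝒳 : Set (EuclideanSpace ℝ (Fin d))) (𝒵 : Set (EuclideanSpace ℝ (Fin dz)))
    (Φ : Set (EuclideanSpace ℝ (Fin dφ))) (Θ : Set (EuclideanSpace ℝ (Fin dθ)))
    (Δ : ℝ) (hΔ : 0 < Δ) (hbdd : Metric.ediam 𝒳 < ENNReal.ofReal (√Δ))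
    (𝒟 : Measure 𝒳) [IsProbabilityMeasure 𝒟]
    (g : Θ → 𝒵 → 𝒳) (hg : ∀ θ, Measurable (g θ))
    (alg : Kernel (Fin n → 𝒳) (VQVAE.Params K 𝒵 Φ Θ)) [IsMarkovKernel alg]
    (q : Kernel (((Fin K → 𝒵) × Φ) × 𝒳) (Fin K)) [IsMarkovKernel q]
    (π : Kernel ((Fin K → 𝒵) × Φ) (Fin K)) [IsMarkovKernel π] :
    ∫⁻ S, ∫⁻ w, VQVAE.W2 𝒟 (VQVAE.generated g π w) ^ 2 ∂(alg S) ∂(Measure.pi fun _ : Fin n => 𝒟)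
      ≤ ENNReal.ofReal (2 * Δ / √(n : ℝ)) +
        ∫⁻ S, ∫⁻ w,
          (2 / (n : ℝ≥0∞) * (∑ m, VQVAE.expectedLoss g q w (S m)) +
            4 * ENNReal.ofReal Δ *
              (2 / (n : ℝ≥0∞) * (∑ m, InformationTheory.klDiv (q ((w.1, w.2.1), S m))
                (π (w.1, w.2.1)))) ^ (1 / 2 : ℝ))
          ∂(alg S) ∂(Measure.pi fun _ : Fin n => 𝒟) := by
  have : NeZero n := ⟨hn.ne'⟩
  have hbound := theorem5_general hΔ.le hbdd.le 𝒟 (fun w j => g w.2.2 (w.1 j))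
    (fun w => measurable_of_finite _) alg
    (q.comap (fun p => ((p.1.1, p.1.2.1), p.2)) (by fun_prop))
    (π.comap (fun w => (w.1, w.2.1)) (by fun_prop))
  simp_rw [Kernel.comap_apply, ← VQVAE.generated_eq_map hg,
    ← VQVAE.expectedLoss_eq_lintegral_edist_sq, ← one_div] at hbound
  exact hbound.trans (by gcongr <;> norm_num)
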